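/- **Theorem 3.1.** Let $d$ be a squarefree positive integer, let $K=\mathbb{Q}(\sqrt d)\subset\mathbb{R}$ and let $R$ be the ring of integers of $K$. Let $u\in R$ be a unit with $u>0$, $u\neq 1$ and $N_{K/\mathbb{Q}}(u)=1$, and let $\Delta=(\Delta_n)_{n\ge 1}$ be the integer sequence $\Delta_n=N_{K/\mathbb{Q}}(u^n-1)$. A primitive prime divisor of $\Delta_n$ is a prime $p$ with $p\mid\Delta_n$ such that $p\nmid\Delta_m$ for all $1\le m<n$ with $\Delta_m\neq 0$. The Zsigmondy bound $Z(\Delta)$ is the largest $n\ge 1$ for which $\Delta_n$ has no primitive prime divisor; it is $\infty$ if there are infinitely many such $n$, and $0$ if there are none. If $u<\frac16$ or $u>6$, then $Z(\Delta)\le 6$. Otherwise one of the following holds: * $u=3+2\sqrt2$ or $u=3-2\sqrt2$, and $Z(\Delta)=2$; * $u=2+\sqrt3$ or $u=2-\sqrt3$, $Z(\Delta)=6$, and the only terms without a primitive prime divisor are $\Delta_4$ and $\Delta_6$; * $u=\frac{3+\sqrt5}{2}$ or $u=\frac{3-\sqrt5}{2}$, $Z(\Delta)=12$, and the only terms without a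 primitive prime divisor are $\Delta_6$, $\Delta_{10}$, $\Delta_{12}$ and the trivial first term $\Delta_1=-1$; * $u=\frac{5+\sqrt{21}}{2}$ or $u=\frac{5-\sqrt{21}}{2}$, $Z(\Delta)=6$, and the only term without a primitive prime divisor is $\Delta_6$. -/

import Mathlib

open scoped NumberField IntermediateField

/-- For a sequence `a 1, a 2, a 3, …` of integers (the value `a 0` is ignored), the prime `p` is a
primitive prime divisor of the term `a n`: it divides `a n`, and it divides no earlier nonzero
term. -/
def IsPrimitivePrimeDivisor (a : ℕ → ℤ) (n p : ℕ) : Prop :=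
  p.Prime ∧ (p : ℤ) ∣ a n ∧ ∀ m : ℕ, 1 ≤ m → m < n → a m ≠ 0 → ¬ (p : ℤ) ∣ a m

/-- The term `a n` has a primitive prime divisor. -/
def HasPrimitivePrimeDivisor (a : ℕ → ℤ) (n : ℕ) : Prop :=
  ∃ p : ℕ, IsPrimitivePrimeDivisor a n p

/-- The set of all indices `n ≥ 1` such that `a n` has no primitive prime divisor. -/
def nonPrimitiveIndices (a : ℕ → ℤ) : Set ℕ :=
  {n : ℕ | 1 ≤ n ∧ ¬ HasPrimitivePrimeDivisor a n}

/-- The Zsigmondy bound `Z(a)`: the largest index `n ≥ 1` such that `a n` has no primitive prime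
divisor, and `∞` if there are infinitely many such indices. (It is `0` if there are none.) -/
noncomputable def zsigmondyBound (a : ℕ → ℤ) : ℕ∞ :=
  ⨆ n ∈ nonPrimitiveIndices a, (n : ℕ∞)

/-- Sanity check: a positive value `N` of the bound is a maximum. -/
theorem zsigmondyBound_eq_of_isGreatest {a : ℕ → ℤ} {N : ℕ}
    (h : IsGreatest (nonPrimitiveIndices a) N) : zsigmondyBound a = N := by
  apply le_antisymm
  · exact iSup₂_le fun n hn => by exact_mod_cast h.2 hn
  · exact le_iSup₂ (f := fun (n : ℕ) (_ : n ∈ nonPrimitiveIndices a) => (n : ℕ∞)) N h.1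

/-- Sanity check: the bound is infinite when infinitely many terms have no primitive prime
divisor. -/
theorem zsigmondyBound_eq_top {a : ℕ → ℤ} (h : (nonPrimitiveIndices a).Infinite) :
    zsigmondyBound a = ⊤ := by
  rw [ENat.eq_top_iff_forall_gt]
  intro m
  obtain ⟨n, hn, hmn⟩ := h.exists_gt m
  exact lt_of_lt_of_le (by exact_mod_cast hmn)
    (le_iSup₂ (f := fun (n : ℕ) (_ : n ∈ nonPrimitiveIndices a) => (n : ℕ∞)) n hn)

/-- The Lehmer–Pierce sequence `Δ n = N(uⁿ - 1)` of a unit `u` of the ring of integers of `K`, as a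
sequence of integers; see `coe_lehmerPierce` for the agreement with the norm of `K/ℚ`. -/
noncomputable def lehmerPierce (K : Type*) [Field K] (u : (𝓞 K)ˣ) (n : ℕ) : ℤ :=
  Algebra.norm ℤ ((u : 𝓞 K) ^ n - 1)

theorem coe_lehmerPierce (K : Type*) [Field K] [NumberField K] (u : (𝓞 K)ˣ) (n : ℕ) :
    (lehmerPierce K u n : ℚ) = Algebra.norm ℚ (((u : 𝓞 K) : K) ^ n - 1) := by
  rw [lehmerPierce, Algebra.coe_norm_int]
  simp

/-- The field `ℚ(√d)`, as a subfield of `ℝ`. -/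
noncomputable abbrev RealQuadraticField (d : ℕ) : IntermediateField ℚ ℝ :=
  ℚ⟮(Real.sqrt (d : ℝ))⟯

instance RealQuadraticField.instNumberField (d : ℕ) : NumberField (RealQuadraticField d) where
  to_charZero := inferInstance
  to_finiteDimensional := IntermediateField.adjoin.finiteDimensional
    ⟨Polynomial.X ^ 2 - Polynomial.C (d : ℚ), Polynomial.monic_X_pow_sub_C _ two_ne_zero, by
      simp⟩

/-- A unit of the ring of integers of `ℚ(√d) ⊆ ℝ`, as a real number. -/
noncomputable def unitToReal {d : ℕ} (u : (𝓞 (RealQuadraticField d))ˣ) : ℝ :=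
  (((u : 𝓞 (RealQuadraticField d)) : RealQuadraticField d) : ℝ)

/-!
Let `t ≥ 3` be the trace of `u`, and let `α`, `β` be the roots of `X² - t X + 1`, so that
`Δ_n = (αⁿ - 1)(βⁿ - 1)`. A prime `p` dividing `Φ_n(α) Φ_n(β)` is primitive for `Δ_n` unless
`n = p^(l+1) m`, where `m` is the rank of apparition of `p`. Since `m` divides `p ± 1`, this happens
for at most one prime when `n ∤ 12`, and for `n ≥ 7`, `n ≠ 12` that prime divides `Φ_n(α) Φ_n(β)` at
most twice. A term without primitive prime divisor therefore has `|Φ_n(α) Φ_n(β)| ≤ p²`, which is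
too small for `n ≥ 7`, except when `n = 10` and `t = 3`. For `n = 12` one uses that
`Φ₁₂(α) Φ₁₂(β) = (t² - 3)²`, whose prime factors other than `2` and `3` are primitive; there is one
as soon as `t ≥ 4`. Finally `u < 1/6` or `u > 6` if and only if `t ≥ 7`, and `t = 3, 4, 5, 6` is a
finite computation.
-/

open Polynomial

section Lucas

/-- The Lucas sequence `V_n(t, 1)`, that is, `αⁿ + βⁿ` for the roots `α` and `β` of `X² - t X + 1`.
It is defined by its recurrence so that individual terms can be computed. -/
def lucasV (t : ℤ) : ℕ → ℤ
  | 0 => 2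
  | 1 => t
  | n + 2 => t * lucasV t (n + 1) - lucasV t n

/-- The integer sequence `(αⁿ - 1)(βⁿ - 1)`, where `α` and `β` are the roots of `X² - t X + 1`: the
Lehmer–Pierce sequence of a quadratic unit of norm `1` and trace `t`. -/
def pierce (t : ℤ) (n : ℕ) : ℤ := 2 - lucasV t n

theorem exists_add_eq_and_mul_eq_one {F : Type*} [Field F] [IsAlgClosed F] (t : F) :
    ∃ α β : F, α + β = t ∧ α * β = 1 := by
  have hdeg : (X ^ 2 - C t * X + 1 : F[X]).degree = 2 := by compute_degree!
  obtain ⟨α, hα⟩ := IsAlgClosed.exists_root (X ^ 2 - C t * X + 1 : F[X]) (by simp [hdeg])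
  have hα' : α ^ 2 - t * α + 1 = 0 := by simpa [IsRoot] using hα
  exact ⟨α, t - α, by ring, by linear_combination -hα'⟩

section Roots

variable {R : Type*} [CommRing R] {t : ℤ} {α β : R}

theorem lucasV_cast (hs : α + β = t) (hp : α * β = 1) : ∀ n, (lucasV t n : R) = α ^ n + β ^ n
  | 0 => by norm_num [lucasV]
  | 1 => by simp [lucasV, hs]
  | n + 2 => by
    simp only [lucasV, Int.cast_sub, Int.cast_mul, lucasV_cast hs hp n, lucasV_cast hs hp (n + 1),
      ← hs]
    linear_combination (α ^ n + β ^ n) * hp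

theorem pierce_cast (hs : α + β = t) (hp : α * β = 1) (n : ℕ) :
    (pierce t n : R) = (α ^ n - 1) * (β ^ n - 1) := by
  rw [pierce, Int.cast_sub, lucasV_cast hs hp, Int.cast_ofNat]
  linear_combination -pow_mul_pow_eq_one n hp

end Roots

theorem lucasV_mul (t : ℤ) (m n : ℕ) : lucasV t (m * n) = lucasV (lucasV t m) n := by
  obtain ⟨α, β, hs, hp⟩ := exists_add_eq_and_mul_eq_one (t : ℂ)
  have h : (lucasV t (m * n) : ℂ) = lucasV (lucasV t m) n := by
    rw [lucasV_cast hs hp, lucasV_cast (lucasV_cast hs hp m).symm (pow_mul_pow_eq_one m hp),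
      pow_mul, pow_mul]
  exact_mod_cast h

theorem lucasV_two (t : ℤ) : lucasV t 2 = t ^ 2 - 2 := by
  simp only [lucasV]
  ring

theorem lucasV_three (t : ℤ) : lucasV t 3 = t ^ 3 - 3 * t := by
  simp only [lucasV]
  ring

theorem lucasV_strictMono {t : ℤ} (ht : 3 ≤ t) : StrictMono (lucasV t) := by
  have h : ∀ n, 2 ≤ lucasV t n ∧ lucasV t n < lucasV t (n + 1) := by
    intro n
    induction n with
    | zero => simp only [lucasV]; omega
    | succ n ih =>
      refine ⟨by omega, ?_⟩
      simp only [lucasV]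
      nlinarith
  exact strictMono_nat_of_lt_succ fun n => (h n).2

theorem three_le_lucasV {t : ℤ} (ht : 3 ≤ t) {n : ℕ} (hn : n ≠ 0) : 3 ≤ lucasV t n :=
  ht.trans ((lucasV_strictMono ht).monotone (Nat.one_le_iff_ne_zero.2 hn))

theorem seven_le_lucasV {t : ℤ} (ht : 3 ≤ t) {n : ℕ} (hn : 2 ≤ n) : 7 ≤ lucasV t n := by
  have h : lucasV t 2 ≤ lucasV t n := (lucasV_strictMono ht).monotone hn
  rw [lucasV_two] at h
  nlinarith

theorem pierce_ne_zero {t : ℤ} (ht : 3 ≤ t) {n : ℕ} (hn : n ≠ 0) : pierce t n ≠ 0 := by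
  have := three_le_lucasV ht hn
  rw [pierce]
  omega

/-- The sum `1 + V₁ + ⋯ + V_h`, which equals `(α^(2h+1) - 1) / (α^h (α - 1))` for each root `α` of
`X² - t X + 1`. Its square is the quotient of `pierce t (2 * h + 1)` by `pierce t 1`. -/
def oddQuotient (t : ℤ) (h : ℕ) : ℤ := 1 + ∑ j ∈ Finset.range h, lucasV t (j + 1)

theorem oddQuotient_succ (t : ℤ) (h : ℕ) :
    oddQuotient t (h + 1) = oddQuotient t h + lucasV t (h + 1) := by
  rw [oddQuotient, oddQuotient, Finset.sum_range_succ, add_assoc]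

theorem oddQuotient_cast_mul {R : Type*} [CommRing R] {t : ℤ} {α β : R} (hs : α + β = t)
    (hp : α * β = 1) (h : ℕ) :
    (oddQuotient t h : R) * (α ^ h * (α - 1)) = α ^ (2 * h + 1) - 1 := by
  induction h with
  | zero => simp [oddQuotient]
  | succ h ih =>
    rw [oddQuotient_succ, Int.cast_add, lucasV_cast hs hp]
    linear_combination α * ih + (α - 1) * pow_mul_pow_eq_one (h + 1) hp

theorem lucasV_odd_sub_two (t : ℤ) (h : ℕ) :
    lucasV t (2 * h + 1) - 2 = (t - 2) * oddQuotient t h ^ 2 := by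
  obtain ⟨α, β, hs, hp⟩ := exists_add_eq_and_mul_eq_one (t : ℂ)
  have hα := oddQuotient_cast_mul hs hp h
  have hβ := oddQuotient_cast_mul (add_comm α β ▸ hs) (mul_comm α β ▸ hp) h
  have key : (2 - lucasV t (2 * h + 1) : ℂ) = (2 - t) * oddQuotient t h ^ 2 := by
    calc (2 - lucasV t (2 * h + 1) : ℂ) = (α ^ (2 * h + 1) - 1) * (β ^ (2 * h + 1) - 1) := by
          simpa [pierce] using pierce_cast hs hp (2 * h + 1)
      _ = oddQuotient t h ^ 2 * ((α * β) ^ h * ((α - 1) * (β - 1))) := by rw [← hα, ← hβ]; ring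
      _ = (2 - t) * oddQuotient t h ^ 2 := by
          rw [hp, one_pow]
          linear_combination (oddQuotient t h : ℂ) ^ 2 * (hp - hs)
  have key' : 2 - lucasV t (2 * h + 1) = (2 - t) * oddQuotient t h ^ 2 := by exact_mod_cast key
  linear_combination -key'

theorem lucasV_modEq_sub_two_sq (t : ℤ) :
    ∀ n : ℕ, lucasV t n ≡ 2 + n ^ 2 * (t - 2) [ZMOD (t - 2) ^ 2]
  | 0 => by simp [lucasV]
  | 1 => by simp [lucasV]
  | n + 2 => by
    have h := ((lucasV_modEq_sub_two_sq t (n + 1)).mul_left t).sub (lucasV_modEq_sub_two_sq t n)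
    refine h.trans (Int.modEq_iff_dvd.2 ⟨-(n + 1) ^ 2, ?_⟩)
    push_cast
    ring

theorem six_mul_oddQuotient_modEq (t : ℤ) (h : ℕ) :
    6 * oddQuotient t h ≡ (2 * h + 1) * (6 + h * (h + 1) * (t - 2)) [ZMOD (t - 2) ^ 2] := by
  induction h with
  | zero => simp [oddQuotient]
  | succ h ih =>
    rw [oddQuotient_succ, mul_add]
    convert ih.add ((lucasV_modEq_sub_two_sq t (h + 1)).mul_left 6) using 1
    push_cast
    ring

theorem four_mul_le_oddQuotient {t : ℤ} (ht : 3 ≤ t) {h : ℕ} (hh : 3 ≤ h) :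
    4 * (2 * h + 1) ≤ oddQuotient t h := by
  induction h, hh using Nat.le_induction with
  | base =>
    have h2 : 7 ≤ lucasV t 2 := seven_le_lucasV ht le_rfl
    have h3 : lucasV t 3 = t * lucasV t 2 - t := rfl
    have h4 : oddQuotient t 3 = 1 + (t + lucasV t 2 + lucasV t 3) := by
      simp [oddQuotient, Finset.sum_range_succ, lucasV]
    push_cast
    nlinarith
  | succ h hh ih =>
    have : 8 ≤ lucasV t (h + 1) := by
      have := (lucasV_strictMono ht) (show 2 < h + 1 by omega)
      have := seven_le_lucasV ht le_rfl
      omega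
    rw [oddQuotient_succ]
    push_cast
    linarith

end Lucas

section CyclotomicNorm

/-- The norm form `f(α) f(β)` of an integer polynomial `f` at the roots `α` and `β` of
`X² - t X + 1`, as a resultant. -/
noncomputable def quadNorm (t : ℤ) (f : ℤ[X]) : ℤ :=
  resultant (X ^ 2 - C t * X + 1) f 2 f.natDegree

theorem quadNorm_cast {R : Type*} [CommRing R] {t : ℤ} {α β : R} (hs : α + β = t)
    (hp : α * β = 1) (f : ℤ[X]) : (quadNorm t f : R) = aeval α f * aeval β f := by
  nontriviality R
  have hfactor : (X ^ 2 - C t * X + 1 : ℤ[X]).map (Int.castRingHom R) =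
      (X - C α) * (X - C β) := by
    have hs' : C α + C β = C (t : R) := by rw [← C_add, hs]
    have hp' : C α * C β = 1 := by rw [← C_mul, hp, C_1]
    simp only [Polynomial.map_add, Polynomial.map_sub, Polynomial.map_mul, Polynomial.map_pow,
      map_X, map_C, Polynomial.map_one, eq_intCast (Int.castRingHom R)]
    linear_combination X * hs' - hp'
  have hdeg : (f.map (Int.castRingHom R)).natDegree ≤ f.natDegree := natDegree_map_le
  have hprod := resultant_mul_left (X - C α) (X - C β) _ _ hdeg
  rw [natDegree_X_sub_C, natDegree_X_sub_C, resultant_X_sub_C_left _ _ _ hdeg,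
    resultant_X_sub_C_left _ _ _ hdeg, ← hfactor, resultant_map_map] at hprod
  simpa [quadNorm, aeval_def, eval_map] using hprod

theorem quadNorm_mul (t : ℤ) (f g : ℤ[X]) :
    quadNorm t (f * g) = quadNorm t f * quadNorm t g := by
  obtain ⟨α, β, hs, hp⟩ := exists_add_eq_and_mul_eq_one (t : ℂ)
  have h : (quadNorm t (f * g) : ℂ) = quadNorm t f * quadNorm t g := by
    simp only [quadNorm_cast hs hp, map_mul]
    ring
  exact_mod_cast h

theorem quadNorm_expand (t : ℤ) (N : ℕ) (f : ℤ[X]) :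
    quadNorm t (expand ℤ N f) = quadNorm (lucasV t N) f := by
  obtain ⟨α, β, hs, hp⟩ := exists_add_eq_and_mul_eq_one (t : ℂ)
  have h : (quadNorm t (expand ℤ N f) : ℂ) = quadNorm (lucasV t N) f := by
    rw [quadNorm_cast hs hp, quadNorm_cast (lucasV_cast hs hp N).symm (pow_mul_pow_eq_one N hp),
      expand_aeval, expand_aeval]
  exact_mod_cast h

theorem quadNorm_X_pow_sub_one (t : ℤ) (n : ℕ) : quadNorm t (X ^ n - 1) = pierce t n := by
  obtain ⟨α, β, hs, hp⟩ := exists_add_eq_and_mul_eq_one (t : ℂ)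
  have h : (quadNorm t (X ^ n - 1) : ℂ) = pierce t n := by
    simp [quadNorm_cast hs hp, pierce_cast hs hp]
  exact_mod_cast h

/-- The value `Φ_n(α) Φ_n(β)` of the cyclotomic polynomial at the roots `α` and `β` of
`X² - t X + 1`: the part of `pierce t n` that can contain primitive prime divisors. -/
noncomputable def cyclotomicNorm (t : ℤ) (n : ℕ) : ℤ := quadNorm t (cyclotomic n ℤ)

theorem pierce_mul_cyclotomicNorm_dvd (t : ℤ) {N n : ℕ} (hN : N ∈ n.properDivisors) :
    pierce t N * cyclotomicNorm t n ∣ pierce t n := by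
  obtain ⟨g, hg⟩ := X_pow_sub_one_mul_cyclotomic_dvd_X_pow_sub_one_of_dvd ℤ hN
  refine ⟨quadNorm t g, ?_⟩
  rw [cyclotomicNorm, ← quadNorm_X_pow_sub_one, ← quadNorm_X_pow_sub_one, hg, quadNorm_mul,
    quadNorm_mul]

theorem cyclotomicNorm_dvd_of_pierce_eq {t : ℤ} (ht : 3 ≤ t) {N n : ℕ}
    (hN : N ∈ n.properDivisors) {q : ℤ} (h : pierce t n = pierce t N * q) :
    cyclotomicNorm t n ∣ q := by
  have hN0 : N ≠ 0 := by
    rintro rfl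
    have h0 := Nat.mem_properDivisors.1 hN
    exact h0.2.ne' (zero_dvd_iff.1 h0.1)
  have hdvd := pierce_mul_cyclotomicNorm_dvd t hN
  rwa [h, mul_dvd_mul_iff_left (pierce_ne_zero ht hN0)] at hdvd

theorem cyclotomicNorm_prime_pow_mul (t : ℤ) {p m : ℕ} (hp : p.Prime) (hpm : ¬ p ∣ m) (l : ℕ) :
    cyclotomicNorm t (p ^ (l + 1) * m) * cyclotomicNorm (lucasV t (p ^ l)) m =
      cyclotomicNorm (lucasV t (p ^ (l + 1))) m := by
  induction l generalizing t with
  | zero =>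
    simp only [zero_add, pow_one, pow_zero, cyclotomicNorm, lucasV]
    rw [← quadNorm_expand, cyclotomic_expand_eq_cyclotomic_mul hp hpm, quadNorm_mul, mul_comm p m]
  | succ l ih =>
    have hexpand : cyclotomicNorm t (p ^ (l + 2) * m) =
        cyclotomicNorm (lucasV t p) (p ^ (l + 1) * m) := by
      rw [cyclotomicNorm, cyclotomicNorm, ← quadNorm_expand, cyclotomic_expand_eq_cyclotomic hp
        ((dvd_pow_self p l.succ_ne_zero).mul_right m), pow_succ _ (l + 1), mul_right_comm]
    rw [hexpand, pow_succ' p (l + 1), lucasV_mul, ← ih (lucasV t p), pow_succ' p l, lucasV_mul t p]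

theorem abs_cyclotomicNorm (t : ℤ) {n : ℕ} (hn : n ≠ 0) :
    ((|cyclotomicNorm t n| : ℤ) : ℝ) = ∏ ζ ∈ primitiveRoots n ℂ, |t - 2 * ζ.re| := by
  obtain ⟨α, β, hs, hp⟩ := exists_add_eq_and_mul_eq_one (t : ℂ)
  have haeval (γ : ℂ) : aeval γ (cyclotomic n ℤ) = ∏ ζ ∈ primitiveRoots n ℂ, (γ - ζ) := by
    rw [aeval_def, ← eval_map, algebraMap_int_eq, map_cyclotomic_int,
      cyclotomic_eq_prod_X_sub_primitiveRoots (Complex.isPrimitiveRoot_exp n hn), eval_prod]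
    simp
  have hfactor {ζ : ℂ} (hζ : ‖ζ‖ = 1) : ‖(α - ζ) * (β - ζ)‖ = |t - 2 * ζ.re| := by
    have h1 : ζ * (starRingEnd ℂ) ζ = 1 := by simp [Complex.mul_conj', hζ]
    have h2 : (α - ζ) * (β - ζ) = -ζ * ((t - 2 * ζ.re : ℝ) : ℂ) := by
      push_cast
      rw [Complex.re_eq_add_conj]
      linear_combination hp - ζ * hs - h1
    rw [h2, norm_mul, norm_neg, hζ, one_mul, Complex.norm_real, Real.norm_eq_abs]
  calc ((|cyclotomicNorm t n| : ℤ) : ℝ) = ‖(cyclotomicNorm t n : ℂ)‖ := by simp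
    _ = ∏ ζ ∈ primitiveRoots n ℂ, ‖(α - ζ) * (β - ζ)‖ := by
      rw [cyclotomicNorm, quadNorm_cast hs hp, haeval, haeval, ← Finset.prod_mul_distrib, norm_prod]
    _ = ∏ ζ ∈ primitiveRoots n ℂ, |t - 2 * ζ.re| := Finset.prod_congr rfl fun ζ hζ =>
      hfactor ((isPrimitiveRoot_of_mem_primitiveRoots hζ).norm'_eq_one hn)

theorem abs_re_le_one_of_mem_primitiveRoots {n : ℕ} (hn : n ≠ 0) {ζ : ℂ}
    (hζ : ζ ∈ primitiveRoots n ℂ) : |ζ.re| ≤ 1 :=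
  (isPrimitiveRoot_of_mem_primitiveRoots hζ).norm'_eq_one hn ▸ Complex.abs_re_le_norm ζ

theorem sub_two_pow_totient_le_abs_cyclotomicNorm {t : ℤ} (ht : 2 ≤ t) {n : ℕ} (hn : n ≠ 0) :
    (t - 2) ^ n.totient ≤ |cyclotomicNorm t n| := by
  have ht' : (2 : ℝ) ≤ t := by exact_mod_cast ht
  have h : (t - 2 : ℝ) ^ n.totient ≤ |cyclotomicNorm t n| := by
    rw [abs_cyclotomicNorm t hn, ← Complex.card_primitiveRoots n]
    refine (Finset.prod_const _).symm.trans_le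
      (Finset.prod_le_prod (fun _ _ => by linarith) fun ζ hζ => ?_)
    have := abs_le.1 (abs_re_le_one_of_mem_primitiveRoots hn hζ)
    exact le_abs.2 (.inl (by linarith))
  exact_mod_cast h

theorem abs_cyclotomicNorm_le {t : ℤ} (ht : 0 ≤ t) {n : ℕ} (hn : n ≠ 0) :
    |cyclotomicNorm t n| ≤ (t + 2) ^ n.totient := by
  have ht' : (0 : ℝ) ≤ t := by exact_mod_cast ht
  have h : ((|cyclotomicNorm t n| : ℤ) : ℝ) ≤ (t + 2) ^ n.totient := by
    rw [abs_cyclotomicNorm t hn, ← Complex.card_primitiveRoots n]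
    refine (Finset.prod_le_prod (fun _ _ => abs_nonneg _) fun ζ hζ => ?_).trans_eq
      (Finset.prod_const _)
    have := abs_le.1 (abs_re_le_one_of_mem_primitiveRoots hn hζ)
    exact abs_le.2 ⟨by linarith, by linarith⟩
  exact_mod_cast h

theorem one_lt_abs_cyclotomicNorm {t : ℤ} (ht : 3 ≤ t) {n : ℕ} (hn : 2 ≤ n) :
    1 < |cyclotomicNorm t n| := by
  have ht' : (3 : ℝ) ≤ t := by exact_mod_cast ht
  have hn0 : n ≠ 0 := by omega
  have hne : (primitiveRoots n ℂ).Nonempty :=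
    ⟨_, (mem_primitiveRoots (by omega)).2 (Complex.isPrimitiveRoot_exp n hn0)⟩
  have h : (1 : ℝ) < |cyclotomicNorm t n| := by
    rw [abs_cyclotomicNorm t hn0]
    refine (Finset.prod_const_one (s := primitiveRoots n ℂ)).symm.trans_lt
      (Finset.prod_lt_prod_of_nonempty (fun _ _ => one_pos) (fun ζ hζ => ?_) hne)
    have hroot := isPrimitiveRoot_of_mem_primitiveRoots hζ
    have hre : ζ.re ≠ ‖ζ‖ := fun hre => hroot.ne_one (by omega) <| by
      rw [Complex.re_eq_norm.1 hre |> Complex.eq_coe_norm_of_nonneg, hroot.norm'_eq_one hn0,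
        Complex.ofReal_one]
    have := (Complex.re_le_norm ζ).lt_of_ne hre
    rw [hroot.norm'_eq_one hn0] at this
    exact lt_abs.2 (.inl (by linarith))
  exact_mod_cast h

end CyclotomicNorm

section Rank

/-- `m` is the rank of apparition of `p` in the sequence `pierce t`: the indices of the terms
divisible by `p` are precisely the multiples of `m`. -/
def IsRank (t : ℤ) (p m : ℕ) : Prop := ∀ j, (p : ℤ) ∣ pierce t j ↔ m ∣ j

variable {t : ℤ} {p m n : ℕ}

theorem isRank_iff_isPrimitiveRoot {F : Type*} [Field F] [CharP F p] {α β : F} (hs : α + β = t)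
    (hαβ : α * β = 1) : IsRank t p m ↔ IsPrimitiveRoot α m := by
  have hdvd (j : ℕ) : (p : ℤ) ∣ pierce t j ↔ α ^ j = 1 := by
    rw [← CharP.intCast_eq_zero_iff F p, pierce_cast hs hαβ, eq_inv_of_mul_eq_one_right hαβ,
      mul_eq_zero, sub_eq_zero, sub_eq_zero, inv_pow, inv_eq_one, or_self]
  simp only [IsRank, hdvd]
  exact ⟨fun h => ⟨(h m).2 dvd_rfl, fun j => (h j).1⟩, fun h => h.pow_eq_one_iff_dvd⟩

theorem exists_charP_add_eq_and_mul_eq_one (t : ℤ) (hp : p.Prime) :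
    ∃ (F : Type) (_ : Field F) (_ : CharP F p) (α β : F), α + β = t ∧ α * β = 1 := by
  have := Fact.mk hp
  exact ⟨AlgebraicClosure (ZMod p), inferInstance,
    charP_of_injective_algebraMap (algebraMap (ZMod p) _).injective p,
    exists_add_eq_and_mul_eq_one _⟩

theorem exists_isRank (t : ℤ) (hp : p.Prime) : ∃ m, IsRank t p m := by
  obtain ⟨F, _, _, α, β, hs, hαβ⟩ := exists_charP_add_eq_and_mul_eq_one t hp
  exact ⟨orderOf α, (isRank_iff_isPrimitiveRoot hs hαβ).2 (IsPrimitiveRoot.orderOf α)⟩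

theorem exists_isRank_of_dvd_cyclotomicNorm (hp : p.Prime) (hn : n ≠ 0)
    (h : (p : ℤ) ∣ cyclotomicNorm t n) : ∃ k m, n = p ^ k * m ∧ IsRank t p m := by
  have := Fact.mk hp
  obtain ⟨F, _, _, α, β, hs, hαβ⟩ := exists_charP_add_eq_and_mul_eq_one t hp
  obtain ⟨k, m, hpm, rfl⟩ := Nat.exists_eq_pow_mul_and_not_dvd hn p hp.ne_one
  have : NeZero (m : F) := ⟨fun h0 => hpm ((CharP.cast_eq_zero_iff F p m).1 h0)⟩
  have hroot : (cyclotomic (p ^ k * m) F).IsRoot α ∨ (cyclotomic (p ^ k * m) F).IsRoot β := by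
    rw [← CharP.intCast_eq_zero_iff F p, cyclotomicNorm, quadNorm_cast hs hαβ, mul_eq_zero] at h
    simpa [aeval_def, eval₂_eq_eval_map, IsRoot] using h
  rw [isRoot_cyclotomic_prime_pow_mul_iff_of_charP, isRoot_cyclotomic_prime_pow_mul_iff_of_charP,
    eq_inv_of_mul_eq_one_right hαβ, IsPrimitiveRoot.inv_iff, or_self] at hroot
  exact ⟨k, m, rfl, (isRank_iff_isPrimitiveRoot hs hαβ).2 hroot⟩

namespace IsRank

/-- The Frobenius map permutes the roots `α` and `α⁻¹` of `X² - t X + 1`, so `α ^ p` is one of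
them. -/
theorem dvd_sub_one_or_dvd_add_one (h : IsRank t p m) (hp : p.Prime) :
    m ∣ p - 1 ∨ m ∣ p + 1 := by
  have := Fact.mk hp
  obtain ⟨F, _, _, α, β, hs, hαβ⟩ := exists_charP_add_eq_and_mul_eq_one t hp
  have hprim := (isRank_iff_isPrimitiveRoot hs hαβ).1 h
  have ht : (t : F) ^ p = t := by simpa only [frobenius_def] using map_intCast (frobenius F p) t
  have hfrob : α ^ p + β ^ p = t := by rw [← add_pow_char, hs, ht]
  have hroots : (α ^ p - α) * (α ^ p - β) = 0 := by
    linear_combination α ^ p * hfrob - pow_mul_pow_eq_one p hαβ - α ^ p * hs + hαβ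
  rw [← hprim.pow_eq_one_iff_dvd, ← hprim.pow_eq_one_iff_dvd]
  refine (mul_eq_zero.1 hroots).imp (fun hα => ?_) fun hβ => ?_
  · apply mul_right_cancel₀ (left_ne_zero_of_mul_eq_one hαβ)
    rw [one_mul, pow_sub_one_mul hp.ne_zero, sub_eq_zero.1 hα]
  · rw [pow_succ, sub_eq_zero.1 hβ, mul_comm, hαβ]

theorem not_dvd (h : IsRank t p m) (hp : p.Prime) : ¬ p ∣ m := fun hpm => by
  have hp2 := hp.two_le
  rcases h.dvd_sub_one_or_dvd_add_one hp with hm | hm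
  · have := Nat.le_of_dvd (by omega) (hpm.trans hm)
    omega
  · exact hp.one_lt.ne' (Nat.dvd_one.1 ((Nat.dvd_add_right dvd_rfl).1 (hpm.trans hm)))

theorem hasPrimitivePrimeDivisor (h : IsRank t p n) (hp : p.Prime) :
    HasPrimitivePrimeDivisor (pierce t) n :=
  ⟨p, hp, (h n).2 dvd_rfl, fun j hj hjn _ hdvd =>
    (Nat.le_of_dvd hj ((h j).1 hdvd)).not_gt hjn⟩

theorem eq_one_or_eq_three (h : IsRank t 2 m) : m = 1 ∨ m = 3 :=
  (h.dvd_sub_one_or_dvd_add_one Nat.prime_two).elim (fun hm => .inl (Nat.dvd_one.1 hm))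
    (Nat.dvd_prime Nat.prime_three).1

theorem dvd_four (h : IsRank t 3 m) : m ∣ 4 :=
  (h.dvd_sub_one_or_dvd_add_one Nat.prime_three).elim (fun hm => hm.trans (by norm_num)) id

end IsRank

theorem exists_isRank_of_not_hasPrimitivePrimeDivisor (hp : p.Prime) (hn : n ≠ 0)
    (h : (p : ℤ) ∣ cyclotomicNorm t n) (hprim : ¬ HasPrimitivePrimeDivisor (pierce t) n) :
    ∃ l m, n = p ^ (l + 1) * m ∧ IsRank t p m := by
  obtain ⟨k, m, hnm, hm⟩ := exists_isRank_of_dvd_cyclotomicNorm hp hn h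
  have hk : k ≠ 0 := by
    rintro rfl
    rw [pow_zero, one_mul] at hnm
    exact hprim (hnm ▸ hm.hasPrimitivePrimeDivisor hp)
  obtain ⟨l, rfl⟩ := Nat.exists_eq_add_one_of_ne_zero hk
  exact ⟨l, m, hnm, hm⟩

theorem dvd_twelve_of_isRank_of_lt {q k l m' : ℕ} (hp : p.Prime) (hq : q.Prime) (hpq : p < q)
    (hm : IsRank t p m) (hm' : IsRank t q m') (hn : n = p ^ (k + 1) * m)
    (hn' : n = q ^ (l + 1) * m') : n ∣ 12 := by
  have hqm : q ∣ m := by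
    have hqn : q ∣ p ^ (k + 1) * m := hn ▸ hn' ▸ (dvd_pow_self q l.succ_ne_zero).mul_right m'
    exact (((Nat.coprime_primes hq hp).2 hpq.ne').pow_right _).dvd_of_dvd_mul_left hqn
  have hqp : q = p + 1 := by
    have hp2 := hp.two_le
    rcases hm.dvd_sub_one_or_dvd_add_one hp with h | h
    · have := Nat.le_of_dvd (by omega) (hqm.trans h)
      omega
    · have := Nat.le_of_dvd (by omega) (hqm.trans h)
      omega
  obtain rfl : p = 2 := by
    refine hp.eq_two_or_odd'.resolve_right fun hodd => ?_
    have hq2 : q = 2 := (hq.even_iff).1 (hqp ▸ hodd.add_one)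
    exact absurd hp.two_le (by omega)
  obtain rfl : q = 3 := hqp
  obtain rfl : m = 3 := hm.eq_one_or_eq_three.resolve_left fun h => by omega
  have h4 : 2 ^ (k + 1) ∣ 4 := by
    have h2 : 2 ^ (k + 1) ∣ 3 ^ (l + 1) * m' := hn' ▸ hn ▸ dvd_mul_right _ _
    exact ((Nat.Coprime.pow _ _ (by norm_num)).dvd_of_dvd_mul_left h2).trans hm'.dvd_four
  exact hn ▸ mul_dvd_mul_right h4 3

end Rank

section Twelve

theorem exists_prime_dvd_sq_sub_three {t : ℤ} (ht : 4 ≤ t) :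
    ∃ p : ℕ, p.Prime ∧ (p : ℤ) ∣ t ^ 2 - 3 ∧ p ≠ 2 ∧ p ≠ 3 := by
  obtain ⟨d, hd⟩ := Int.eq_ofNat_of_zero_le (a := t ^ 2 - 3) (by nlinarith)
  have hd13 : 13 ≤ d := by
    zify
    rw [← hd]
    nlinarith
  have hmod {k : ℕ} (hk : ∀ x : ZMod k, x ^ 2 - 3 ≠ 0) : ¬ k ∣ d := fun hkd => hk t <| by
    have := (ZMod.intCast_zmod_eq_zero_iff_dvd _ k).2 (Int.natCast_dvd_natCast.2 hkd)
    simpa [← hd] using this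
  obtain ⟨e, he⟩ := Nat.gcd_dvd_left d 6
  have hgcd : d.gcd 6 ≤ 6 := Nat.gcd_le_right d (by norm_num)
  obtain ⟨p, hp, hpe⟩ := Nat.exists_prime_and_dvd (n := e) (by rintro rfl; omega)
  have hpd : p ∣ d := he ▸ hpe.mul_left _
  have hsq (hp6 : p ∣ 6) : p * p ∣ d := he ▸ mul_dvd_mul (Nat.dvd_gcd hpd hp6) hpe
  refine ⟨p, hp, hd ▸ Int.natCast_dvd_natCast.2 hpd, ?_, ?_⟩
  · rintro rfl
    exact hmod (k := 2 * 2) (by decide) (hsq (by norm_num))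
  · rintro rfl
    exact hmod (k := 3 * 3) (by decide) (hsq (by norm_num))

theorem hasPrimitivePrimeDivisor_pierce_twelve {t : ℤ} (ht : 4 ≤ t) :
    HasPrimitivePrimeDivisor (pierce t) 12 := by
  obtain ⟨p, hp, hpd, hp2, hp3⟩ := exists_prime_dvd_sq_sub_three ht
  obtain ⟨m, hm⟩ := exists_isRank t hp
  have h4 : (p : ℤ) ∣ pierce t 4 - 3 :=
    hpd.trans ⟨-(t ^ 2 - 1), by simp only [pierce, lucasV]; ring⟩
  have h6 : (p : ℤ) ∣ pierce t 6 - 4 :=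
    hpd.trans ⟨-(t ^ 2 - 3) * t ^ 2, by simp only [pierce, lucasV]; ring⟩
  have h12 : (p : ℤ) ∣ pierce t 12 :=
    hpd.trans ⟨(t ^ 2 - 3) * t ^ 2 * (4 - (t ^ 2 - 3) ^ 2 * t ^ 2), by
      simp only [pierce, lucasV]; ring⟩
  have hm4 : ¬ m ∣ 4 := fun h => hp3 <| by
    have h3 : (p : ℤ) ∣ (3 : ℕ) := by simpa using dvd_sub ((hm 4).2 h) h4
    exact (Nat.prime_dvd_prime_iff_eq hp Nat.prime_three).1 (Int.natCast_dvd_natCast.1 h3)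
  have hm6 : ¬ m ∣ 6 := fun h => hp2 <| by
    have h4 : (p : ℤ) ∣ (2 ^ 2 : ℕ) := by simpa using dvd_sub ((hm 6).2 h) h6
    exact (Nat.prime_dvd_prime_iff_eq hp Nat.prime_two).1
      (hp.dvd_of_dvd_pow (Int.natCast_dvd_natCast.1 h4))
  have hdiv : ∀ k ∈ Nat.divisors 12, ¬ k ∣ 4 → ¬ k ∣ 6 → k = 12 := by decide
  have hm12 : m = 12 := hdiv m (Nat.mem_divisors.2 ⟨(hm 12).1 h12, by norm_num⟩) hm4 hm6
  exact (hm12 ▸ hm).hasPrimitivePrimeDivisor hp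

end Twelve

section Zsigmondy

variable {t : ℤ} {p m n l : ℕ}

theorem prime_sq_dvd_of_cube_dvd_sq {p D : ℤ} (hp : Prime p) (h : p ^ 3 ∣ D ^ 2) : p ^ 2 ∣ D := by
  obtain ⟨E, rfl⟩ := hp.dvd_of_dvd_pow ((dvd_pow_self _ three_ne_zero).trans h)
  rw [mul_pow, pow_succ, mul_dvd_mul_iff_left (pow_ne_zero _ hp.ne_zero)] at h
  rw [sq]
  exact mul_dvd_mul_left _ (hp.dvd_of_dvd_pow h)

theorem cyclotomicNorm_dvd_of_lucasV_eq (ht : 3 ≤ t) {N : ℕ} (hN : N ∈ n.properDivisors) {q : ℤ}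
    (h : lucasV t n - 2 = (lucasV t N - 2) * q) : cyclotomicNorm t n ∣ q :=
  cyclotomicNorm_dvd_of_pierce_eq ht hN (by simp only [pierce]; linear_combination -h)

theorem mem_properDivisors_mul {N k : ℕ} (hN : N ≠ 0) (hk : 1 < k) :
    N ∈ (N * k).properDivisors :=
  Nat.mem_properDivisors.2 ⟨dvd_mul_right N k, lt_mul_of_one_lt_right (Nat.pos_of_ne_zero hN) hk⟩

theorem not_two_cube_dvd_cyclotomicNorm (ht : 3 ≤ t) (hn : n ≠ 0) (h : (2 : ℤ) ∣ pierce t n) :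
    ¬ (2 : ℤ) ^ 3 ∣ cyclotomicNorm t (n * 4 * 2) := by
  intro hdvd
  have hquot : cyclotomicNorm t (n * 4 * 2) ∣ lucasV t (n * 4) + 2 :=
    cyclotomicNorm_dvd_of_lucasV_eq ht (mem_properDivisors_mul (by omega) one_lt_two) <| by
      rw [lucasV_mul t (n * 4), lucasV_two]
      ring
  have hsq : lucasV t (n * 4) + 2 = (lucasV t n ^ 2 - 2) ^ 2 := by
    rw [lucasV_mul]
    simp only [lucasV]
    ring
  obtain ⟨r, hr⟩ := h
  have hV : lucasV t n = 2 - 2 * r := by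
    rw [← hr, pierce]
    ring
  obtain ⟨s, hs⟩ := hdvd.trans (hsq ▸ hquot)
  rw [hV] at hs
  ring_nf at hs
  omega

theorem not_three_cube_dvd_cyclotomicNorm (ht : 3 ≤ t) (hn : n ≠ 0) (h : (3 : ℤ) ∣ pierce t n) :
    ¬ (3 : ℤ) ^ 3 ∣ cyclotomicNorm t (n * 3 * 3) := by
  intro hdvd
  have hquot : cyclotomicNorm t (n * 3 * 3) ∣ (lucasV t (n * 3) + 1) ^ 2 :=
    cyclotomicNorm_dvd_of_lucasV_eq ht (mem_properDivisors_mul (by omega) (by omega)) <| by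
      rw [lucasV_mul t (n * 3), lucasV_three]
      ring
  obtain ⟨r, hr⟩ := h
  have hV : lucasV t n = 2 - 3 * r := by
    rw [← hr, pierce]
    ring
  obtain ⟨s, hs⟩ := prime_sq_dvd_of_cube_dvd_sq Int.prime_three (hdvd.trans hquot)
  rw [lucasV_mul, lucasV_three, hV] at hs
  ring_nf at hs
  omega

theorem not_prime_sq_dvd_oddQuotient {h : ℕ} (hp : (2 * h + 1).Prime) (hh : 2 ≤ h)
    (ht : (2 * h + 1 : ℤ) ∣ t - 2) : ¬ (2 * h + 1 : ℤ) ^ 2 ∣ oddQuotient t h := by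
  intro hdvd
  have hmod := (six_mul_oddQuotient_modEq t h).of_dvd (pow_dvd_pow_of_dvd ht 2)
  have hsq : (2 * h + 1 : ℤ) ^ 2 ∣ (2 * h + 1) * (6 + h * (h + 1) * (t - 2)) :=
    hmod.dvd_iff.1 (hdvd.mul_left 6)
  rw [sq, mul_dvd_mul_iff_left (by positivity), Int.dvd_add_left (ht.mul_left _)] at hsq
  have h6 : 2 * h + 1 ∣ 6 := by exact_mod_cast hsq
  have := Nat.le_of_dvd (by norm_num) h6
  obtain rfl : h = 2 := by omega
  omega

theorem not_prime_cube_dvd_cyclotomicNorm (ht : 3 ≤ t) (hp : p.Prime) (hp5 : 5 ≤ p) (hn : n ≠ 0)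
    (h : (p : ℤ) ∣ pierce t n) : ¬ (p : ℤ) ^ 3 ∣ cyclotomicNorm t (n * p) := by
  intro hdvd
  obtain ⟨k, rfl⟩ := hp.odd_of_ne_two (by omega)
  have hquot : cyclotomicNorm t (n * (2 * k + 1)) ∣ oddQuotient (lucasV t n) k ^ 2 :=
    cyclotomicNorm_dvd_of_lucasV_eq ht (mem_properDivisors_mul hn hp.one_lt) <| by
      rw [lucasV_mul, lucasV_odd_sub_two]
  have hsq := prime_sq_dvd_of_cube_dvd_sq (Nat.prime_iff_prime_int.1 hp) (hdvd.trans hquot)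
  push_cast at h hsq
  refine not_prime_sq_dvd_oddQuotient hp (by omega) ?_ hsq
  rwa [← dvd_neg, neg_sub]

theorem IsRank.two_le_of_two_pow (h : IsRank t 2 m) (hn : 7 ≤ 2 ^ (l + 1) * m)
    (hn12 : 2 ^ (l + 1) * m ≠ 12) : 2 ≤ l := by
  by_contra! hl
  interval_cases l <;> rcases h.eq_one_or_eq_three with rfl | rfl <;> omega

theorem IsRank.one_le_of_three_pow (h : IsRank t 3 m) (hn : 7 ≤ 3 ^ (l + 1) * m)
    (hn12 : 3 ^ (l + 1) * m ≠ 12) : 1 ≤ l := by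
  by_contra! hl
  have := Nat.le_of_dvd (by norm_num) h.dvd_four
  have := h.dvd_four
  interval_cases l
  interval_cases m <;> omega

theorem IsRank.not_cube_dvd_cyclotomicNorm (h : IsRank t p m) (ht : 3 ≤ t) (hp : p.Prime)
    (hn : 7 ≤ p ^ (l + 1) * m) (hn12 : p ^ (l + 1) * m ≠ 12) :
    ¬ (p : ℤ) ^ 3 ∣ cyclotomicNorm t (p ^ (l + 1) * m) := by
  have hm : m ≠ 0 := by
    rintro rfl
    omega
  have hdvd (k : ℕ) : (p : ℤ) ∣ pierce t (p ^ k * m) := (h _).2 (dvd_mul_left m _)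
  have hne (k : ℕ) : p ^ k * m ≠ 0 := mul_ne_zero (pow_ne_zero k hp.ne_zero) hm
  rcases (by have := hp.two_le; have := hp.ne_one; omega : p = 2 ∨ p = 3 ∨ p = 4 ∨ 5 ≤ p)
    with rfl | rfl | rfl | hp5
  · obtain ⟨l, rfl⟩ := Nat.exists_eq_add_of_le' (h.two_le_of_two_pow hn hn12)
    rw [show 2 ^ (l + 2 + 1) * m = 2 ^ l * m * 4 * 2 by ring]
    exact_mod_cast not_two_cube_dvd_cyclotomicNorm ht (hne l) (hdvd l)
  · obtain ⟨l, rfl⟩ := Nat.exists_eq_add_of_le' (h.one_le_of_three_pow hn hn12)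
    rw [show 3 ^ (l + 1 + 1) * m = 3 ^ l * m * 3 * 3 by ring]
    exact_mod_cast not_three_cube_dvd_cyclotomicNorm ht (hne l) (hdvd l)
  · exact absurd hp (by norm_num)
  · rw [pow_succ p, mul_right_comm]
    exact not_prime_cube_dvd_cyclotomicNorm ht hp hp5 (hne l) (hdvd l)

theorem lt_abs_cyclotomicNorm_of_mul_pow_lt (ht : 3 ≤ t) (hp : p.Prime) (hpm : ¬ p ∣ m) {B : ℤ}
    (hB : B * (lucasV t (p ^ l) + 2) ^ m.totient < (lucasV t (p ^ (l + 1)) - 2) ^ m.totient) :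
    B < |cyclotomicNorm t (p ^ (l + 1) * m)| := by
  have hm : m ≠ 0 := by
    rintro rfl
    exact hpm (dvd_zero p)
  have hs := three_le_lucasV ht (pow_ne_zero l hp.ne_zero)
  have hS := three_le_lucasV ht (pow_ne_zero (l + 1) hp.ne_zero)
  refine lt_of_mul_lt_mul_right ?_ (pow_nonneg (by linarith : 0 ≤ lucasV t (p ^ l) + 2) m.totient)
  calc B * (lucasV t (p ^ l) + 2) ^ m.totient
      < (lucasV t (p ^ (l + 1)) - 2) ^ m.totient := hB
    _ ≤ |cyclotomicNorm (lucasV t (p ^ (l + 1))) m| :=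
        sub_two_pow_totient_le_abs_cyclotomicNorm (by linarith) hm
    _ = |cyclotomicNorm t (p ^ (l + 1) * m)| * |cyclotomicNorm (lucasV t (p ^ l)) m| := by
        rw [← cyclotomicNorm_prime_pow_mul t hp hpm, abs_mul]
    _ ≤ |cyclotomicNorm t (p ^ (l + 1) * m)| * (lucasV t (p ^ l) + 2) ^ m.totient := by
        gcongr
        exact abs_cyclotomicNorm_le (by linarith) hm

theorem lt_abs_cyclotomicNorm_of_mul_lt (ht : 3 ≤ t) (hp : p.Prime) (hpm : ¬ p ∣ m) {B : ℤ}
    (hB1 : 1 ≤ B) (hB : B * (lucasV t (p ^ l) + 2) < lucasV t (p ^ (l + 1)) - 2) :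
    B < |cyclotomicNorm t (p ^ (l + 1) * m)| := by
  have hs := three_le_lucasV ht (pow_ne_zero l hp.ne_zero)
  have hφ : m.totient ≠ 0 := by
    rw [Nat.totient_eq_zero.ne]
    rintro rfl
    exact hpm (dvd_zero p)
  refine lt_abs_cyclotomicNorm_of_mul_pow_lt ht hp hpm ?_
  calc B * (lucasV t (p ^ l) + 2) ^ m.totient
      ≤ B ^ m.totient * (lucasV t (p ^ l) + 2) ^ m.totient :=
        mul_le_mul_of_nonneg_right (le_self_pow₀ hB1 hφ) (pow_nonneg (by linarith) _)
    _ = (B * (lucasV t (p ^ l) + 2)) ^ m.totient := (mul_pow _ _ _).symm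
    _ < _ := pow_lt_pow_left₀ hB (mul_nonneg (by linarith) (by linarith)) hφ

theorem lucasV_five_sub_two (t : ℤ) : lucasV t 5 - 2 = (t - 2) * (t ^ 2 + t - 1) ^ 2 := by
  simp only [lucasV]
  ring

theorem four_mul_add_two_lt_lucasV_two (ht : 7 ≤ t) : 4 * (t + 2) < lucasV t 2 - 2 := by
  rw [lucasV_two]
  nlinarith

theorem nine_mul_add_two_lt_lucasV_three (ht : 7 ≤ t) : 9 * (t + 2) < lucasV t 3 - 2 := by
  have hsq : 49 ≤ t ^ 2 := by nlinarith
  rw [lucasV_three]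
  nlinarith

theorem twentyFive_mul_add_two_lt_lucasV_five (ht : 4 ≤ t) : 25 * (t + 2) < lucasV t 5 - 2 := by
  have h19 : 19 ≤ t ^ 2 + t - 1 := by nlinarith
  rw [lucasV_five_sub_two]
  nlinarith

theorem sq_mul_add_two_lt_lucasV (ht : 3 ≤ t) {h : ℕ} (hh : 3 ≤ h) :
    (2 * h + 1) ^ 2 * (t + 2) < lucasV t (2 * h + 1) - 2 := by
  have hD := four_mul_le_oddQuotient ht hh
  have hD2 : (4 * (2 * h + 1)) ^ 2 ≤ oddQuotient t h ^ 2 := by gcongr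
  rw [lucasV_odd_sub_two]
  calc (2 * h + 1) ^ 2 * (t + 2) < (2 * h + 1) ^ 2 * (16 * (t - 2)) :=
        mul_lt_mul_of_pos_left (by linarith) (by positivity)
    _ = (t - 2) * (4 * (2 * h + 1)) ^ 2 := by ring
    _ ≤ (t - 2) * oddQuotient t h ^ 2 := mul_le_mul_of_nonneg_left hD2 (by linarith)

theorem sq_lt_abs_cyclotomicNorm_five_mul (hm : ¬ 5 ∣ m) (hφ : 2 ≤ m.totient) :
    5 ^ 2 < |cyclotomicNorm 3 (5 * m)| := by
  have h := lt_abs_cyclotomicNorm_of_mul_pow_lt (t := 3) (l := 0) (B := 5 ^ 2) le_rfl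
    Nat.prime_five hm <|
    calc (5 ^ 2 * (lucasV 3 (5 ^ 0) + 2) ^ m.totient : ℤ)
        ≤ 5 ^ m.totient * 5 ^ m.totient := by
          simp only [pow_zero, lucasV]
          norm_num only
          exact mul_le_mul_of_nonneg_right
            (pow_le_pow_right₀ (by norm_num : (1 : ℤ) ≤ 5) hφ) (by positivity)
      _ = 25 ^ m.totient := by rw [← mul_pow]; norm_num
      _ < 121 ^ m.totient := pow_lt_pow_left₀ (by norm_num) (by norm_num) (by omega)
  simpa using h

theorem IsRank.two_le_totient_of_five (h : IsRank t 5 m) (hn : 7 ≤ 5 * m) (hn10 : 5 * m ≠ 10) :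
    2 ≤ m.totient := by
  rcases h.dvd_sub_one_or_dvd_add_one Nat.prime_five with hm | hm <;>
  · have := Nat.le_of_dvd (by norm_num) hm
    interval_cases m <;> first | decide | omega

theorem IsRank.sq_lt_abs_cyclotomicNorm (h : IsRank t p m) (ht : 3 ≤ t) (hp : p.Prime)
    (hn : 7 ≤ p ^ (l + 1) * m) (hn12 : p ^ (l + 1) * m ≠ 12)
    (hn10 : p ^ (l + 1) * m = 10 → t ≠ 3) :
    (p : ℤ) ^ 2 < |cyclotomicNorm t (p ^ (l + 1) * m)| := by
  have hpm := h.not_dvd hp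
  have hs := three_le_lucasV ht (pow_ne_zero l hp.ne_zero)
  have hB1 : (1 : ℤ) ≤ (p : ℤ) ^ 2 := by exact_mod_cast pow_pos hp.pos 2
  have hsmall (hlt : (p : ℤ) ^ 2 * (lucasV t (p ^ l) + 2) < lucasV (lucasV t (p ^ l)) p - 2) :
      (p : ℤ) ^ 2 < |cyclotomicNorm t (p ^ (l + 1) * m)| :=
    lt_abs_cyclotomicNorm_of_mul_lt ht hp hpm hB1 (by rwa [pow_succ p, lucasV_mul])
  rcases (by have := hp.two_le; omega : p = 2 ∨ p = 3 ∨ p = 4 ∨ p = 5 ∨ p = 6 ∨ 7 ≤ p)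
    with rfl | rfl | rfl | rfl | rfl | hp7
  · have hl := h.two_le_of_two_pow hn hn12
    exact hsmall (four_mul_add_two_lt_lucasV_two
      (seven_le_lucasV ht (hl.trans Nat.lt_two_pow_self.le)))
  · have hl := h.one_le_of_three_pow hn hn12
    exact hsmall (nine_mul_add_two_lt_lucasV_three
      (seven_le_lucasV ht (hl.trans_lt (Nat.lt_pow_self (by norm_num)))))
  · exact absurd hp (by norm_num)
  · rcases hs.eq_or_lt with hs3 | hs4
    · have hl : l = 0 := by
        by_contra hl
        have := seven_le_lucasV ht (Nat.one_lt_pow hl (by norm_num : 1 < 5))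
        omega
      subst hl
      obtain rfl : t = 3 := hs3.symm
      rw [zero_add, pow_one] at hn hn10 ⊢
      exact sq_lt_abs_cyclotomicNorm_five_mul hpm
        (h.two_le_totient_of_five hn fun h10 => hn10 h10 rfl)
    · exact hsmall (twentyFive_mul_add_two_lt_lucasV_five hs4)
  · exact absurd hp (by norm_num)
  · obtain ⟨k, rfl⟩ := hp.odd_of_ne_two (by omega)
    exact hsmall (by exact_mod_cast sq_mul_add_two_lt_lucasV hs (by omega : 3 ≤ k))

theorem hasPrimitivePrimeDivisor_pierce (ht : 3 ≤ t) (hn : 7 ≤ n) (hn12 : n = 12 → t ≠ 3)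
    (hn10 : n = 10 → t ≠ 3) : HasPrimitivePrimeDivisor (pierce t) n := by
  by_cases h12 : n = 12
  · subst h12
    exact hasPrimitivePrimeDivisor_pierce_twelve (lt_of_le_of_ne ht (hn12 rfl).symm)
  by_contra hprim
  obtain ⟨c, hc⟩ := Int.eq_ofNat_of_zero_le (abs_nonneg (cyclotomicNorm t n))
  have hdvd {k : ℕ} : (k : ℤ) ∣ cyclotomicNorm t n ↔ k ∣ c := by
    rw [← dvd_abs, hc, Int.natCast_dvd_natCast]
  have hc1 : 1 < c := by
    zify
    rw [← hc]
    exact one_lt_abs_cyclotomicNorm ht (by omega)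
  have hrank {q : ℕ} (hq : q.Prime) (hqc : q ∣ c) : ∃ l m, n = q ^ (l + 1) * m ∧ IsRank t q m :=
    exists_isRank_of_not_hasPrimitivePrimeDivisor hq (by omega : n ≠ 0) (hdvd.2 hqc) hprim
  have hle {p q : ℕ} (hp : p.Prime) (hq : q.Prime) (hpc : p ∣ c) (hqc : q ∣ c) : q ≤ p := by
    obtain ⟨k, m, hnm, hm⟩ := hrank hp hpc
    obtain ⟨l, m', hnm', hm'⟩ := hrank hq hqc
    by_contra! hpq
    have h := dvd_twelve_of_isRank_of_lt hp hq hpq hm hm' hnm hnm'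
    exact h12 (Nat.eq_of_dvd_of_lt_two_mul (by norm_num) h (by omega)).symm
  obtain ⟨p, hp, hpc⟩ := Nat.exists_prime_and_dvd hc1.ne'
  obtain ⟨l, m, rfl, hm⟩ := hrank hp hpc
  have hpow := Nat.eq_prime_pow_of_unique_prime_dvd (p := p) (n := c) (by omega)
    fun {q} hq hqc => le_antisymm (hle hp hq hpc hqc) (hle hq hp hqc hpc)
  have hsize : p ^ 2 < c := by
    zify
    rw [← hc]
    exact hm.sq_lt_abs_cyclotomicNorm ht hp hn h12 hn10
  have hcube : p ^ 3 ∣ c := by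
    rw [hpow] at hsize ⊢
    exact pow_dvd_pow p ((Nat.pow_lt_pow_iff_right hp.one_lt).1 hsize)
  exact hm.not_cube_dvd_cyclotomicNorm ht hp hn h12 (by exact_mod_cast hdvd.2 hcube)

end Zsigmondy

section SmallTrace

theorem dvd_pow_log2_succ {x P : ℕ} (hx : x ≠ 0) (hP : P ≠ 0)
    (h : ∀ p : ℕ, p.Prime → p ∣ x → p ∣ P) : x ∣ P ^ (x.log2 + 1) := by
  rw [← Nat.factorization_le_iff_dvd hx (pow_ne_zero _ hP)]
  intro p
  by_cases hpx : p.Prime ∧ p ∣ x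
  · rw [Nat.factorization_pow, Finsupp.smul_apply, smul_eq_mul]
    calc x.factorization p ≤ x.log2 + 1 :=
          Nat.factorization_le_of_le_pow
            (Nat.lt_log2_self.le.trans (Nat.pow_le_pow_left hpx.1.two_le _))
      _ ≤ (x.log2 + 1) * P.factorization p :=
          Nat.le_mul_of_pos_right _ (hpx.1.factorization_pos_of_dvd hP (h p hpx.1 hpx.2))
  · rw [Nat.factorization_eq_zero_iff x p |>.2 (by tauto)]
    exact Nat.zero_le _

theorem not_hasPrimitivePrimeDivisor_iff {a : ℕ → ℤ} (ha : ∀ m, m ≠ 0 → a m ≠ 0) {n : ℕ}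
    (hn : n ≠ 0) : ¬ HasPrimitivePrimeDivisor a n ↔
      a n ∣ (∏ m ∈ Finset.Ico 1 n, a m) ^ ((a n).natAbs.log2 + 1) := by
  have hne {m : ℕ} (hm : m ∈ Finset.Ico 1 n) : a m ≠ 0 :=
    ha m (Nat.one_le_iff_ne_zero.1 (Finset.mem_Ico.1 hm).1)
  constructor
  · intro h
    rw [← Int.natAbs_dvd_natAbs, Int.natAbs_pow]
    refine dvd_pow_log2_succ (Int.natAbs_ne_zero.2 (ha n hn))
      (Int.natAbs_ne_zero.2 (Finset.prod_ne_zero_iff.2 fun m => hne)) fun p hp hpn => ?_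
    rw [← Int.natCast_dvd] at hpn ⊢
    by_contra hprod
    exact h ⟨p, hp, hpn, fun m hm hmn _ hpm =>
      hprod (hpm.trans (Finset.dvd_prod_of_mem a (Finset.mem_Ico.2 ⟨hm, hmn⟩)))⟩
  · rintro h ⟨p, hp, hpn, hprim⟩
    have hp' := Nat.prime_iff_prime_int.1 hp
    obtain ⟨m, hm, hpm⟩ := (hp'.dvd_finsetProd_iff a).1 (hp'.dvd_of_dvd_pow (hpn.trans h))
    exact hprim m (Finset.mem_Ico.1 hm).1 (Finset.mem_Ico.1 hm).2 (hne hm) hpm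

/-- The indices `n` of `pierce t` without a primitive prime divisor, for `3 ≤ t`, as a finite set
that can be computed by evaluation. The exponent exceeds the multiplicity of every prime in
`pierce t n`, so the divisibility says that each prime factor of the term divides an earlier one. -/
def computedNonPrimitiveIndices (t : ℤ) : Finset ℕ :=
  {n ∈ Finset.Icc 1 12 |
    pierce t n ∣ (∏ m ∈ Finset.Ico 1 n, pierce t m) ^ ((pierce t n).natAbs.log2 + 1)}

theorem nonPrimitiveIndices_pierce {t : ℤ} (ht : 3 ≤ t) :
    nonPrimitiveIndices (pierce t) = computedNonPrimitiveIndices t := by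
  ext n
  have hle (h : ¬ HasPrimitivePrimeDivisor (pierce t) n) : n ≤ 12 := by
    by_contra! hn
    exact h (hasPrimitivePrimeDivisor_pierce ht (by omega) (by omega) (by omega))
  rw [computedNonPrimitiveIndices, Finset.mem_coe, Finset.mem_filter, Finset.mem_Icc, and_assoc]
  refine and_congr_right fun hn => ?_
  rw [← not_hasPrimitivePrimeDivisor_iff (fun m => pierce_ne_zero ht) (by omega)]
  exact (and_iff_right_of_imp hle).symm

theorem nonPrimitiveIndices_pierce_three : nonPrimitiveIndices (pierce 3) = {1, 6, 10, 12} := by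
  have h : computedNonPrimitiveIndices 3 = {1, 6, 10, 12} := by decide +kernel
  rw [nonPrimitiveIndices_pierce le_rfl, h]
  simp

theorem nonPrimitiveIndices_pierce_four : nonPrimitiveIndices (pierce 4) = {4, 6} := by
  have h : computedNonPrimitiveIndices 4 = {4, 6} := by decide +kernel
  rw [nonPrimitiveIndices_pierce (by norm_num), h]
  simp

theorem nonPrimitiveIndices_pierce_five : nonPrimitiveIndices (pierce 5) = {6} := by
  have h : computedNonPrimitiveIndices 5 = {6} := by decide +kernel
  rw [nonPrimitiveIndices_pierce (by norm_num), h]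
  simp

theorem nonPrimitiveIndices_pierce_six : nonPrimitiveIndices (pierce 6) = {2} := by
  have h : computedNonPrimitiveIndices 6 = {2} := by decide +kernel
  rw [nonPrimitiveIndices_pierce (by norm_num), h]
  simp

theorem zsigmondyBound_pierce_three : zsigmondyBound (pierce 3) = 12 :=
  zsigmondyBound_eq_of_isGreatest (by
    rw [nonPrimitiveIndices_pierce_three]; simp [IsGreatest, upperBounds])

theorem zsigmondyBound_pierce_four : zsigmondyBound (pierce 4) = 6 :=
  zsigmondyBound_eq_of_isGreatest (by
    rw [nonPrimitiveIndices_pierce_four]; simp [IsGreatest, upperBounds])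

theorem zsigmondyBound_pierce_five : zsigmondyBound (pierce 5) = 6 :=
  zsigmondyBound_eq_of_isGreatest (by
    rw [nonPrimitiveIndices_pierce_five]; simp [IsGreatest, upperBounds])

theorem zsigmondyBound_pierce_six : zsigmondyBound (pierce 6) = 2 :=
  zsigmondyBound_eq_of_isGreatest (by
    rw [nonPrimitiveIndices_pierce_six]; simp [IsGreatest, upperBounds])

theorem zsigmondyBound_pierce_le_six {t : ℤ} (ht : 4 ≤ t) : zsigmondyBound (pierce t) ≤ 6 := by
  refine iSup₂_le fun n hn => ?_
  by_contra! h
  have h7 : 6 < n := by exact_mod_cast h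
  exact hn.2 (hasPrimitivePrimeDivisor_pierce (by omega) h7 (by omega) (by omega))

end SmallTrace

section QuadraticField

section NormTrace

variable {R S : Type*} [CommRing R] [Nontrivial R] [CommRing S] [Algebra R S] [Module.Free R S]

theorem algebraMap_norm_eq_mul (h : Module.finrank R S = 2) (x : S) :
    algebraMap R S (Algebra.norm R x) = x * (algebraMap R S (Algebra.trace R S x) - x) := by
  have : Module.Finite R S := Module.finite_of_finrank_eq_succ h
  let b := Module.finBasisOfFinrankEq R S h
  have hchar : (Algebra.lmul R S x).charpoly =
      X ^ 2 - C (Algebra.trace R S x) * X + C (Algebra.norm R x) := by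
    rw [← LinearMap.charpoly_toMatrix _ b, Matrix.charpoly_fin_two, Algebra.norm_eq_matrix_det b,
      Algebra.trace_eq_matrix_trace b]
    rfl
  have hx := Algebra.aeval_self_charpoly_lmul (R := R) x
  rw [hchar] at hx
  simp only [map_add, map_sub, map_mul, map_pow, aeval_X, aeval_C] at hx
  linear_combination hx

theorem add_eq_algebraMap_trace (h : Module.finrank R S = 2) {x y : S} (hxy : x * y = 1)
    (hx : Algebra.norm R x = 1) : x + y = algebraMap R S (Algebra.trace R S x) := by
  have hconj := algebraMap_norm_eq_mul h x
  rw [hx, map_one] at hconj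
  linear_combination y * hconj + (algebraMap R S (Algebra.trace R S x) - x) * hxy

theorem algebraMap_norm_sub_one (h : Module.finrank R S = 2) {x y : S} (hxy : x * y = 1)
    (hx : Algebra.norm R x = 1) : algebraMap R S (Algebra.norm R (x - 1)) = (x - 1) * (y - 1) := by
  have htrace : algebraMap R S (Algebra.trace R S 1) = 2 := by
    rw [← map_one (algebraMap R S), Algebra.trace_algebraMap, h, nsmul_one,
      Nat.cast_ofNat, map_ofNat]
  rw [algebraMap_norm_eq_mul h, map_sub, map_sub, htrace, ← add_eq_algebraMap_trace h hxy hx]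
  ring

end NormTrace

variable {K : Type*} [Field K] [NumberField K] {u : (𝓞 K)ˣ}

theorem unit_add_inv_eq_trace (hK : Module.finrank ℚ K = 2)
    (hu : Algebra.norm ℤ (u : 𝓞 K) = 1) :
    (u : 𝓞 K) + (u⁻¹ : (𝓞 K)ˣ) = (Algebra.trace ℤ (𝓞 K) u : ℤ) := by
  simpa using add_eq_algebraMap_trace (NumberField.RingOfIntegers.rank K ▸ hK) u.mul_inv hu

theorem lehmerPierce_eq_pierce (hK : Module.finrank ℚ K = 2)
    (hu : Algebra.norm ℤ (u : 𝓞 K) = 1) :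
    lehmerPierce K u = pierce (Algebra.trace ℤ (𝓞 K) u) := by
  have hrank : Module.finrank ℤ (𝓞 K) = 2 := NumberField.RingOfIntegers.rank K ▸ hK
  funext n
  have h : (lehmerPierce K u n : 𝓞 K) = pierce (Algebra.trace ℤ (𝓞 K) u) n := by
    rw [pierce_cast (unit_add_inv_eq_trace hK hu) u.mul_inv]
    exact algebraMap_norm_sub_one hrank (pow_mul_pow_eq_one n u.mul_inv)
      (by rw [map_pow, hu, one_pow])
  exact_mod_cast h

end QuadraticField

section RealEmbedding

variable {x : ℝ} {t : ℤ}

theorem three_le_of_add_inv_eq (hx : 0 < x) (hx1 : x ≠ 1) (h : x + x⁻¹ = t) : 3 ≤ t := by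
  have hpos : 0 < (x - 1) ^ 2 * x⁻¹ :=
    mul_pos (sq_pos_of_ne_zero (sub_ne_zero.2 hx1)) (inv_pos.2 hx)
  have h2 : ((2 : ℤ) : ℝ) < t := by
    rw [← h, Int.cast_ofNat]
    linear_combination hpos + (x - 2) * mul_inv_cancel₀ hx.ne'
  exact Int.add_one_le_of_lt (by exact_mod_cast h2)

theorem lt_or_lt_iff_of_add_inv_eq (hx : 0 < x) (h : x + x⁻¹ = t) :
    (x < 1 / 6 ∨ 6 < x) ↔ 7 ≤ t := by
  have hfactor : (x - 1 / 6) * (x - 6) = x * (t - 37 / 6) := by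
    linear_combination x * h - mul_inv_cancel₀ hx.ne'
  constructor
  · intro hx'
    have hpos : 0 < x * (t - 37 / 6) := by
      rw [← hfactor]
      rcases hx' with hx' | hx' <;> nlinarith
    have h6 : ((6 : ℤ) : ℝ) < t := by
      rw [Int.cast_ofNat]
      linarith [pos_of_mul_pos_right hpos hx.le]
    exact Int.add_one_le_of_lt (by exact_mod_cast h6)
  · intro ht
    have ht' : (7 : ℝ) ≤ t := by exact_mod_cast ht
    by_contra! hx'
    nlinarith

theorem eq_or_eq_of_add_inv_eq {x s r r' : ℝ} (hx : x ≠ 0) (h : x + x⁻¹ = s) (hadd : r + r' = s)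
    (hmul : r * r' = 1) : x = r ∨ x = r' := by
  have hroots : (x - r) * (x - r') = 0 := by
    linear_combination x * h - mul_inv_cancel₀ hx - x * hadd + hmul
  exact (mul_eq_zero.1 hroots).imp sub_eq_zero.1 sub_eq_zero.1

end RealEmbedding

theorem eq_one_of_norm_eq_one_of_finrank_eq_one {F L : Type*} [Field F] [Field L] [Algebra F L]
    (h : Module.finrank F L = 1) {x : L} (hx : Algebra.norm F x = 1) : x = 1 := by
  have hmem : x ∈ (⊥ : Subalgebra F L) :=
    Subalgebra.bot_eq_top_of_finrank_eq_one h ▸ Algebra.mem_top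
  obtain ⟨q, rfl⟩ := Algebra.mem_bot.1 hmem
  rw [Algebra.norm_algebraMap, h, pow_one] at hx
  rw [hx, map_one]

theorem finrank_realQuadraticField_le_two (d : ℕ) :
    Module.finrank ℚ (RealQuadraticField d) ≤ 2 := by
  have hroot : aeval (√(d : ℝ)) (X ^ 2 - C (d : ℚ)) = 0 := by simp
  have hmonic := monic_X_pow_sub_C (d : ℚ) two_ne_zero
  rw [IntermediateField.adjoin.finrank ⟨_, hmonic, hroot⟩]
  exact (natDegree_le_natDegree (minpoly.min ℚ (√(d : ℝ)) hmonic hroot)).trans_eq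
    natDegree_X_pow_sub_C

theorem finrank_realQuadraticField_eq_two {d : ℕ} {x : RealQuadraticField d} (hx : x ≠ 1)
    (hnorm : Algebra.norm ℚ x = 1) : Module.finrank ℚ (RealQuadraticField d) = 2 := by
  have hpos : 0 < Module.finrank ℚ (RealQuadraticField d) := Module.finrank_pos
  have hne : Module.finrank ℚ (RealQuadraticField d) ≠ 1 := fun h =>
    hx (eq_one_of_norm_eq_one_of_finrank_eq_one h hnorm)
  have hle := finrank_realQuadraticField_le_two d
  omega

theorem exists_lehmerPierce_eq_pierce {K : Type*} [Field K] [NumberField K]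
    (hK : Module.finrank ℚ K = 2) (σ : K →+* ℝ) {u : (𝓞 K)ˣ} (hu_ne : u ≠ 1)
    (hu_pos : 0 < σ (u : 𝓞 K)) (hu_norm : Algebra.norm ℚ ((u : 𝓞 K) : K) = 1) :
    ∃ t : ℤ, 3 ≤ t ∧ σ (u : 𝓞 K) + (σ (u : 𝓞 K))⁻¹ = t ∧ lehmerPierce K u = pierce t := by
  have hnorm : Algebra.norm ℤ (u : 𝓞 K) = 1 := by
    rw [← Algebra.coe_norm_int] at hu_norm
    exact_mod_cast hu_norm
  let τ : 𝓞 K →+* ℝ := σ.comp (algebraMap (𝓞 K) K)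
  have hτ : τ u + (τ u)⁻¹ = (Algebra.trace ℤ (𝓞 K) u : ℤ) := by
    rw [← map_units_inv, ← map_add, unit_add_inv_eq_trace hK hnorm, map_intCast]
  have hne : τ u ≠ 1 := fun h => hu_ne (Units.ext (NumberField.RingOfIntegers.ext
    (σ.injective (h.trans (by simp)))))
  exact ⟨_, three_le_of_add_inv_eq hu_pos hne hτ, hτ, lehmerPierce_eq_pierce hK hnorm⟩

theorem theorem3p1_general {K : Type*} [Field K] [NumberField K] (hK : Module.finrank ℚ K = 2)
    (σ : K →+* ℝ) (u : (𝓞 K)ˣ) (hu_ne : u ≠ 1) (hu_pos : 0 < σ (u : 𝓞 K))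
    (hu_norm : Algebra.norm ℚ ((u : 𝓞 K) : K) = 1) :
    ((σ (u : 𝓞 K) < 1 / 6 ∨ 6 < σ (u : 𝓞 K)) → zsigmondyBound (lehmerPierce K u) ≤ 6) ∧
    (¬ (σ (u : 𝓞 K) < 1 / 6 ∨ 6 < σ (u : 𝓞 K)) →
      ((σ (u : 𝓞 K) = 3 + 2 * √2 ∨ σ (u : 𝓞 K) = 3 - 2 * √2) ∧
        zsigmondyBound (lehmerPierce K u) = 2) ∨
      ((σ (u : 𝓞 K) = 2 + √3 ∨ σ (u : 𝓞 K) = 2 - √3) ∧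
        zsigmondyBound (lehmerPierce K u) = 6 ∧
        nonPrimitiveIndices (lehmerPierce K u) = {4, 6}) ∨
      ((σ (u : 𝓞 K) = (3 + √5) / 2 ∨ σ (u : 𝓞 K) = (3 - √5) / 2) ∧
        zsigmondyBound (lehmerPierce K u) = 12 ∧
        nonPrimitiveIndices (lehmerPierce K u) = {1, 6, 10, 12}) ∨
      ((σ (u : 𝓞 K) = (5 + √21) / 2 ∨ σ (u : 𝓞 K) = (5 - √21) / 2) ∧
        zsigmondyBound (lehmerPierce K u) = 6 ∧
        nonPrimitiveIndices (lehmerPierce K u) = {6})) := by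
  obtain ⟨t, ht, hut, hΔ⟩ := exists_lehmerPierce_eq_pierce hK σ hu_ne hu_pos hu_norm
  rw [hΔ, lt_or_lt_iff_of_add_inv_eq hu_pos hut]
  refine ⟨fun ht7 => zsigmondyBound_pierce_le_six (by omega), fun ht7 => ?_⟩
  have hsq (k : ℕ) : √(k : ℝ) ^ 2 = k := Real.sq_sqrt k.cast_nonneg
  push Not at ht7
  interval_cases t
  · refine .inr (.inr (.inl ⟨?_, zsigmondyBound_pierce_three, nonPrimitiveIndices_pierce_three⟩))
    exact eq_or_eq_of_add_inv_eq hu_pos.ne' hut (by norm_num; ring)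
      (by linear_combination -hsq 5 / 4)
  · refine .inr (.inl ⟨?_, zsigmondyBound_pierce_four, nonPrimitiveIndices_pierce_four⟩)
    exact eq_or_eq_of_add_inv_eq hu_pos.ne' hut (by norm_num)
      (by linear_combination -hsq 3)
  · refine .inr (.inr (.inr ⟨?_, zsigmondyBound_pierce_five, nonPrimitiveIndices_pierce_five⟩))
    exact eq_or_eq_of_add_inv_eq hu_pos.ne' hut (by norm_num; ring)
      (by linear_combination -hsq 21 / 4)
  · refine .inl ⟨?_, zsigmondyBound_pierce_six⟩
    exact eq_or_eq_of_add_inv_eq hu_pos.ne' hut (by norm_num)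
      (by linear_combination -4 * hsq 2)

theorem theorem3p1 (d : ℕ) (hd : Squarefree d)
    (u : (𝓞 (RealQuadraticField d))ˣ)
    (hu_ne : u ≠ 1)
    (hu_pos : 0 < unitToReal u)
    (hu_norm : Algebra.norm ℚ ((u : 𝓞 (RealQuadraticField d)) : RealQuadraticField d) = 1) :
    ((unitToReal u < 1 / 6 ∨ 6 < unitToReal u) →
      zsigmondyBound (lehmerPierce (RealQuadraticField d) u) ≤ 6) ∧
    (¬ (unitToReal u < 1 / 6 ∨ 6 < unitToReal u) →
      ((unitToReal u = 3 + 2 * Real.sqrt 2 ∨ unitToReal u = 3 - 2 * Real.sqrt 2) ∧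
        zsigmondyBound (lehmerPierce (RealQuadraticField d) u) = 2) ∨
      ((unitToReal u = 2 + Real.sqrt 3 ∨ unitToReal u = 2 - Real.sqrt 3) ∧
        zsigmondyBound (lehmerPierce (RealQuadraticField d) u) = 6 ∧
        nonPrimitiveIndices (lehmerPierce (RealQuadraticField d) u) = {4, 6}) ∨
      ((unitToReal u = (3 + Real.sqrt 5) / 2 ∨ unitToReal u = (3 - Real.sqrt 5) / 2) ∧
        zsigmondyBound (lehmerPierce (RealQuadraticField d) u) = 12 ∧
        nonPrimitiveIndices (lehmerPierce (RealQuadraticField d) u) = {1, 6, 10, 12}) ∨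
      ((unitToReal u = (5 + Real.sqrt 21) / 2 ∨ unitToReal u = (5 - Real.sqrt 21) / 2) ∧
        zsigmondyBound (lehmerPierce (RealQuadraticField d) u) = 6 ∧
        nonPrimitiveIndices (lehmerPierce (RealQuadraticField d) u) = {6})) := by
  have hne : ((u : 𝓞 (RealQuadraticField d)) : RealQuadraticField d) ≠ 1 := fun h =>
    hu_ne (Units.ext (NumberField.RingOfIntegers.ext h))
  exact theorem3p1_general (finrank_realQuadraticField_eq_two hne hu_norm)
    (RealQuadraticField d).val.toRingHom u hu_ne hu_pos hu_norm
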